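/- There are absolute constants $c>0$ and $C$ such that for every $K\in\mathbb R$ and all integers $h\ge 1$, $D\ge 1$, $n\ge 0$ there is a finite undirected graph $G=(V,E)$ with positive integral edge lengths and unique shortest paths such that $G$ has highway dimension exactly $h$, $\tfrac1C D\le \operatorname{diam}(G)\le C D$, $|V|\ge n$, and such that the following holds for every set $T\subseteq V$ of transit nodes with $|T|\le K\sqrt{|V|}$ and every choice of access nodes $A(v)\subseteq T$ $(v\in V)$. (1) For every admissible locality filter and every contraction ordering, the average query time of transit node routing, over all $(s,t)\in V\times V$, is at least $c\,h^2$. (2) If fewer than $\tfrac1{16}|V|^2$ of the pairs $(s,t)$ are local, then at least $c|V|$ vertices $v$ satisfy $|A(v)|\ge c\,h$. Here the highway dimension is the smallest $h$ such that for all $r>0$ and all $v\in V$ there is $H\subseteq V$ with $|H|\le h$ that meets every shortest path of length at least $r$ contained in the ball $B_{4r}(v)=\{u:\operatorname{dist}(u,v)<4r\}$. The query $(s,t)$ is global if $\min\{\operatorname{dist}(s,u)+\operatorname{dist}(u,v)+\operatorname{dist}(v,t): u\in A(s),\,v\in A(t)\}=\operatorname{dist}(s,t)$ (the minimum over the empty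 set being $\infty$), and local otherwise. A locality filter classifies every query as global or local and is admissible if it classifies no local query as global (it may classify global queries as local). A query $(s,t)$ classified as global takes time $|A(s)|\cdot|A(t)|$ (all pairs of access nodes are tried). A query classified as local is answered by contraction hierarchies: all vertices are contracted in the given ordering, where contracting $v$ deletes $v$ from the current graph and adds, for each two neighbours $u,w$ of $v$ such that $u$–$v$–$w$ is a shortest path whose length is smaller than the distance of $u$ and $w$ after deleting $v$, an edge $uw$ of that length; $E^+$ is the set of all added edges; the query runs exhaustive searches from $s$ and from $t$ in $(V,E\cup E^+)$ which at a vertex $v$ only scan the edges $vw$ with $w$ contracted after $v$, and its time is the total number of vertices settled and edges scanned by the two searches. -/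

import Mathlib

open scoped ENNReal

/-- An undirected graph with nonnegative integral edge lengths.
Values of `len` on non-adjacent pairs are never used. -/
structure WGraph (V : Type) where
  graph : SimpleGraph V
  len : V → V → ℕ
  len_comm : ∀ u v, len u v = len v u

namespace WGraph

variable {V : Type}

/-- Length of a walk: the sum of the lengths of its edges. -/
def walkLen (G : WGraph V) {u v : V} (p : G.graph.Walk u v) : ℕ :=
  (p.darts.map (fun d => G.len d.fst d.snd)).sum

/-- Shortest-path distance; `⊤` if there is no path. -/
noncomputable def sdist (G : WGraph V) (u v : V) : ℕ∞ :=
  ⨅ p : G.graph.Walk u v, (G.walkLen p : ℕ∞)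

/-- `p` is a shortest path from `u` to `v`. -/
def IsShortestPath (G : WGraph V) {u v : V} (p : G.graph.Walk u v) : Prop :=
  p.IsPath ∧ (G.walkLen p : ℕ∞) = G.sdist u v

/-- Between any two vertices there is at most one shortest path. -/
def UniqueShortestPaths (G : WGraph V) : Prop :=
  ∀ (u v : V) (p q : G.graph.Walk u v), G.IsShortestPath p → G.IsShortestPath q → p = q

/-- The (weighted) diameter. -/
noncomputable def diam (G : WGraph V) : ℕ∞ :=
  ⨆ u : V, ⨆ v : V, G.sdist u v

/-- The open ball `B_ρ(v)`: all `u` with `dist(u,v) < ρ`. -/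
def ball (G : WGraph V) (v : V) (ρ : ℝ) : Set V :=
  {u | (G.sdist u v : ℝ≥0∞) < ENNReal.ofReal ρ}

/-- `H` covers (meets) all shortest paths of length at least `r` that lie in `B`. -/
def Covers (G : WGraph V) (H : Finset V) (r : ℝ) (B : Set V) : Prop :=
  ∀ (u w : V) (p : G.graph.Walk u w), G.IsShortestPath p → r ≤ (G.walkLen p : ℝ) →
    (∀ x ∈ p.support, x ∈ B) → ∃ x ∈ p.support, x ∈ H

/-- The highway dimension: the smallest `h` such that for every `r > 0` and every ball `B_{4r}(v)`
some set of at most `h` vertices covers all shortest paths of length at least `r` in the ball. -/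
noncomputable def highwayDim (G : WGraph V) : ℕ :=
  sInf {h : ℕ | ∀ r : ℝ, 0 < r → ∀ v : V, ∃ H : Finset V,
    H.card ≤ h ∧ G.Covers H r (G.ball v (4 * r))}

theorem walkLen_reverse (G : WGraph V) {u v : V} (p : G.graph.Walk u v) :
    G.walkLen p.reverse = G.walkLen p := by
  simp only [walkLen, SimpleGraph.Walk.darts_reverse, List.map_reverse, List.sum_reverse,
    List.map_map]
  congr 1
  apply List.map_congr_left
  intro d _
  exact G.len_comm _ _

theorem sdist_comm (G : WGraph V) (u v : V) : G.sdist u v = G.sdist v u := by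
  apply le_antisymm
  · exact le_iInf fun p => (iInf_le _ p.reverse).trans (by rw [walkLen_reverse])
  · exact le_iInf fun p => (iInf_le _ p.reverse).trans (by rw [walkLen_reverse])

/-! ### Contraction hierarchies -/

/-- Delete `v`, i.e. remove all its incident edges. (`v` stays in the vertex type as an isolated
vertex, which has no influence on paths between the other vertices.) -/
def delete (G : WGraph V) (v : V) : WGraph V where
  graph :=
    { Adj := fun u w => G.graph.Adj u w ∧ u ≠ v ∧ w ≠ v
      symm := ⟨fun _ _ h => ⟨h.1.symm, h.2.2, h.2.1⟩⟩
      loopless := ⟨fun u h => G.graph.loopless.irrefl u h.1⟩ }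
  len := G.len
  len_comm := G.len_comm

/-- When `v` is contracted in the current graph `G`, an edge between its neighbors `u` and `w` is
needed to preserve the shortest path lengths: `u`–`v`–`w` is a shortest path, and the distance
from `u` to `w` increases when `v` is deleted. -/
def NeedsShortcut (G : WGraph V) (v u w : V) : Prop :=
  u ≠ w ∧ G.graph.Adj u v ∧ G.graph.Adj v w ∧
    G.sdist u w = ((G.len u v + G.len v w : ℕ) : ℕ∞) ∧
    ((G.len u v + G.len v w : ℕ) : ℕ∞) < (G.delete v).sdist u w

theorem NeedsShortcut.symm {G : WGraph V} {v u w : V} (h : G.NeedsShortcut v u w) :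
    G.NeedsShortcut v w u := by
  obtain ⟨h1, h2, h3, h4, h5⟩ := h
  have e : G.len w v + G.len v u = G.len u v + G.len v w := by
    rw [G.len_comm w v, G.len_comm v u, Nat.add_comm]
  refine ⟨h1.symm, h3.symm, h2.symm, ?_, ?_⟩
  · rw [e, sdist_comm, h4]
  · rw [e, sdist_comm]; exact h5

open Classical in
/-- The contraction of `v`: delete `v`, then add the needed shortcuts between its neighbors. -/
noncomputable def contract (G : WGraph V) (v : V) : WGraph V where
  graph :=
    { Adj := fun u w => (G.delete v).graph.Adj u w ∨ G.NeedsShortcut v u w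
      symm := ⟨fun _ _ h => h.imp (fun h => h.symm) (fun h => h.symm)⟩
      loopless := ⟨fun u h => h.elim ((G.delete v).graph.loopless.irrefl u) (fun h => h.1 rfl)⟩ }
  len := fun u w => if G.NeedsShortcut v u w then G.len u v + G.len v w else G.len u w
  len_comm := fun u w => by
    by_cases h : G.NeedsShortcut v u w
    · rw [if_pos h, if_pos h.symm, G.len_comm w v, G.len_comm v u, Nat.add_comm]
    · rw [if_neg h, if_neg (fun h' => h h'.symm), G.len_comm]

variable [Fintype V]

/-- The current graph after the first `i` contractions; `θ v` is the position of `v` in the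
contraction ordering. -/
noncomputable def overlay (G : WGraph V) (θ : V ≃ Fin (Fintype.card V)) : ℕ → WGraph V
  | 0 => G
  | i + 1 =>
    if h : i < Fintype.card V then (overlay G θ i).contract (θ.symm ⟨i, h⟩) else overlay G θ i

/-- `u`–`w` belongs to the set `E⁺` of shortcut edges: it is added when some vertex `v` is
contracted. -/
def IsShortcut (G : WGraph V) (θ : V ≃ Fin (Fintype.card V)) (u w : V) : Prop :=
  ∃ v : V, (G.overlay θ (θ v)).NeedsShortcut v u w

/-- An edge `u`–`w` of `G⁺ = (V, E ∪ E⁺)` that is considered at `u` in a query: `w` was contracted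
after `u`. -/
def UpArc (G : WGraph V) (θ : V ≃ Fin (Fintype.card V)) (u w : V) : Prop :=
  (G.graph.Adj u w ∨ G.IsShortcut θ u w) ∧ θ u < θ w

/-- The vertices settled by the search from `s`: those reachable from `s` along upward edges. -/
def settled (G : WGraph V) (θ : V ≃ Fin (Fintype.card V)) (s : V) : Set V :=
  {v | Relation.ReflTransGen (G.UpArc θ) s v}

/-- The upward edges scanned by the search from `s`. -/
def scanned (G : WGraph V) (θ : V ≃ Fin (Fintype.card V)) (s : V) : Set (V × V) :=
  {e | e.1 ∈ G.settled θ s ∧ G.UpArc θ e.1 e.2}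

/-- Running time of the search from `s`: settled vertices plus scanned edges. -/
noncomputable def searchTime (G : WGraph V) (θ : V ≃ Fin (Fintype.card V)) (s : V) : ℕ :=
  (G.settled θ s).ncard + (G.scanned θ s).ncard

/-- Running time of an `s`–`t` query of contraction hierarchies (bidirectional upward search). -/
noncomputable def chTime (G : WGraph V) (θ : V ≃ Fin (Fintype.card V)) (s t : V) : ℕ :=
  G.searchTime θ s + G.searchTime θ t

/-! ### Transit node routing -/

/-- The `s`–`t` query is global for the access nodes `A`. -/
def IsGlobal (G : WGraph V) (A : V → Finset V) (s t : V) : Prop :=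
  (⨅ u ∈ A s, ⨅ v ∈ A t, (G.sdist s u + G.sdist u v + G.sdist v t)) = G.sdist s t

open Classical in
/-- Running time of an `s`–`t` query of transit node routing with access nodes `A`. `F s t` says
that the locality filter classifies the query as global; then all pairs of access nodes are tried.
All other queries are answered by contraction hierarchies with contraction ordering `θ`. -/
noncomputable def tnrTime (G : WGraph V) (A : V → Finset V) (F : V → V → Prop)
    (θ : V ≃ Fin (Fintype.card V)) (s t : V) : ℕ :=
  if F s t then (A s).card * (A t).card else G.chTime θ s t

/-- Average of `tnrTime` over all ordered pairs of vertices. -/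
noncomputable def avgTnrTime (G : WGraph V) (A : V → Finset V) (F : V → V → Prop)
    (θ : V ≃ Fin (Fintype.card V)) : ℝ :=
  (∑ s : V, ∑ t : V, (G.tnrTime A F θ s t : ℝ)) / (Fintype.card V : ℝ) ^ 2

end WGraph

/-! The graph has $h$ pairwise adjacent hubs and $N$ leaves of each type $i<h$, with $N\ge h^2$
large. A leaf is at distance $D$ from the hub of its type and $2D$ from each higher hub; hubs are
$2D$ apart. Two leaves of types $i\ne j$ then meet only in hub $\max(i,j)$, so a global query
between leaves outside $T$ forces this hub into both access sets (`hub_mem_of_isGlobal`). Charging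
the query to the leaf of smaller type shows that leaves with few access nodes have few global pairs
(`card_global_le`). As $|T|$ is small against $hN$, this already gives (2).

For (1), a constant fraction of the leaves has search time of order $h^2$ in every contraction
ordering (`card_expensive_ge`). A hub contracted before half of its leaves leaves a clique of
shortcuts among them; if instead most hubs come after half of their leaves, those leaves climb into
a clique of order $h$ hubs. Among expensive leaves outside $T$, either many have order $h$ access
nodes, and pairs of these are slow however they are classified, or many have few, and most of their
pairs are local.

Distances and shortcuts are controlled through an explicit metric that certifies unique shortest
paths (`IsGeodesic`). -/

namespace WGraph

variable {V : Type}

/-! ### Walk lengths and lower bounds on distances -/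

@[simp]
theorem walkLen_nil (G : WGraph V) {u : V} :
    G.walkLen (SimpleGraph.Walk.nil : G.graph.Walk u u) = 0 := by
  simp [walkLen]

@[simp]
theorem walkLen_cons (G : WGraph V) {u v w : V} (e : G.graph.Adj u v) (p : G.graph.Walk v w) :
    G.walkLen (SimpleGraph.Walk.cons e p) = G.len u v + G.walkLen p := by
  simp [walkLen]

theorem sdist_le_walkLen (G : WGraph V) {u v : V} (p : G.graph.Walk u v) :
    G.sdist u v ≤ (G.walkLen p : ℕ∞) :=
  iInf_le _ p

theorem sdist_le_len (G : WGraph V) {u v : V} (e : G.graph.Adj u v) :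
    G.sdist u v ≤ (G.len u v : ℕ∞) := by
  simpa using G.sdist_le_walkLen (SimpleGraph.Walk.cons e .nil)

/-- A semimetric that is bounded by the length of every edge is bounded by the length of every
walk. -/
theorem le_walkLen {G : WGraph V} {δ : V → V → ℕ} (hself : ∀ v, δ v v = 0)
    (htri : ∀ u v w, δ u w ≤ δ u v + δ v w) (hlen : ∀ u v, G.graph.Adj u v → δ u v ≤ G.len u v)
    {u v : V} (p : G.graph.Walk u v) : δ u v ≤ G.walkLen p := by
  induction p with
  | nil => simp [hself]
  | @cons a b c e p ih =>
    rw [walkLen_cons]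
    exact (htri a b c).trans (add_le_add (hlen _ _ e) ih)

theorem le_sdist {G : WGraph V} {δ : V → V → ℕ} (hself : ∀ v, δ v v = 0)
    (htri : ∀ u v w, δ u w ≤ δ u v + δ v w) (hlen : ∀ u v, G.graph.Adj u v → δ u v ≤ G.len u v)
    (u v : V) : (δ u v : ℕ∞) ≤ G.sdist u v :=
  le_iInf fun p => by exact_mod_cast le_walkLen hself htri hlen p

/-! ### Metrics certifying unique shortest paths -/

/-- `δ` is a metric inducing the edge lengths of `G`, and between any two vertices there is exactly
one first edge of a path realizing it. -/
structure IsGeodesic (G : WGraph V) (δ : V → V → ℕ) : Prop where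
  self : ∀ v, δ v v = 0
  pos : ∀ u v, u ≠ v → 0 < δ u v
  tri : ∀ u v w, δ u w ≤ δ u v + δ v w
  len_eq : ∀ u v, G.graph.Adj u v → G.len u v = δ u v
  exists_next : ∀ u v, u ≠ v → ∃ x, G.graph.Adj u x ∧ δ u v = δ u x + δ x v
  next_unique : ∀ u v x y, u ≠ v → G.graph.Adj u x → G.graph.Adj u y →
    δ u v = δ u x + δ x v → δ u v = δ u y + δ y v → x = y

namespace IsGeodesic

variable {G : WGraph V} {δ : V → V → ℕ}

theorem exists_walk (hG : G.IsGeodesic δ) (u v : V) :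
    ∃ p : G.graph.Walk u v, G.walkLen p = δ u v := by
  induction hn : δ u v using Nat.strong_induction_on generalizing u with
  | _ n ih =>
    by_cases huv : u = v
    · subst huv
      exact ⟨.nil, by rw [walkLen_nil, ← hn, hG.self]⟩
    · obtain ⟨x, hx, hd⟩ := hG.exists_next u v huv
      have h1 := hG.pos u x hx.ne
      obtain ⟨p, hp⟩ := ih (δ x v) (by omega) x rfl
      exact ⟨.cons hx p, by rw [walkLen_cons, hp, hG.len_eq _ _ hx, ← hn, hd]⟩

theorem le_walkLen (hG : G.IsGeodesic δ) {u v : V} (p : G.graph.Walk u v) :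
    δ u v ≤ G.walkLen p :=
  WGraph.le_walkLen hG.self hG.tri (fun u v e => (hG.len_eq u v e).ge) p

theorem sdist_eq (hG : G.IsGeodesic δ) (u v : V) : G.sdist u v = δ u v := by
  apply le_antisymm
  · obtain ⟨p, hp⟩ := hG.exists_walk u v
    exact hp ▸ G.sdist_le_walkLen p
  · exact le_sdist hG.self hG.tri (fun u v e => (hG.len_eq u v e).ge) u v

/-- The first edge of a walk of length `δ u v` is tight for `δ`, hence determined by `next_unique`;
the remainders are again tight. -/
theorem walk_unique (hG : G.IsGeodesic δ) {u v : V} (p q : G.graph.Walk u v)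
    (hp : G.walkLen p = δ u v) (hq : G.walkLen q = δ u v) : p = q := by
  induction p with
  | nil =>
    cases q with
    | nil => rfl
    | cons e q =>
      rw [walkLen_cons, hG.len_eq _ _ e, hG.self] at hq
      have := hG.pos _ _ e.ne
      omega
  | @cons a b c e p ih =>
    cases q with
    | nil =>
      rw [walkLen_cons, hG.len_eq _ _ e, hG.self] at hp
      have := hG.pos _ _ e.ne
      omega
    | @cons _ x _ f q =>
      rw [walkLen_cons, hG.len_eq _ _ e] at hp
      rw [walkLen_cons, hG.len_eq _ _ f] at hq
      have h1 := hG.le_walkLen p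
      have h2 := hG.le_walkLen q
      have h3 := hG.tri a b c
      have h4 := hG.tri a x c
      have hac : a ≠ c := by
        rintro rfl
        have := hG.pos _ _ e.ne
        rw [hG.self] at hp
        omega
      obtain rfl : b = x := hG.next_unique a c b x hac e f (by omega) (by omega)
      rw [ih q (by omega) (by omega)]

theorem uniqueShortestPaths (hG : G.IsGeodesic δ) : G.UniqueShortestPaths := by
  intro u v p q hp hq
  refine hG.walk_unique p q ?_ ?_
  · have := hp.2
    rw [hG.sdist_eq] at this
    exact_mod_cast this
  · have := hq.2
    rw [hG.sdist_eq] at this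
    exact_mod_cast this

theorem isShortestPath_edge (hG : G.IsGeodesic δ) {u v : V} (e : G.graph.Adj u v) :
    G.IsShortestPath (SimpleGraph.Walk.cons e .nil) := by
  refine ⟨by simp [e.ne], ?_⟩
  rw [hG.sdist_eq, walkLen_cons, walkLen_nil, hG.len_eq _ _ e, Nat.add_zero]

/-- If a query is global, some pair of access nodes lies on a shortest path. -/
theorem exists_of_isGlobal (hG : G.IsGeodesic δ) {A : V → Finset V} {s t : V}
    (h : G.IsGlobal A s t) : ∃ u ∈ A s, ∃ v ∈ A t, δ s u + δ u v + δ v t = δ s t := by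
  by_contra! hne
  -- By integrality, a detour through any pair of access nodes costs at least one unit more; an
  -- empty infimum is `⊤`.
  have key : ((δ s t + 1 : ℕ) : ℕ∞) ≤
      ⨅ u ∈ A s, ⨅ v ∈ A t, (G.sdist s u + G.sdist u v + G.sdist v t) := by
    refine le_iInf₂ fun u hu => le_iInf₂ fun v hv => ?_
    rw [hG.sdist_eq, hG.sdist_eq, hG.sdist_eq]
    have h1 := hne u hu v hv
    have h2 := hG.tri s u t
    have h3 := hG.tri u v t
    have h4 : δ s t + 1 ≤ δ s u + δ u v + δ v t := by omega
    exact_mod_cast h4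
  rw [h, hG.sdist_eq] at key
  have : δ s t + 1 ≤ δ s t := by exact_mod_cast key
  omega

/-! ### Shortcuts created by contraction -/

variable [Fintype V]

/-- Edges of the current graph are original edges or detours over contracted vertices; original
edges between remaining vertices keep their lengths. -/
theorem overlay_invariant (hG : G.IsGeodesic δ) (θ : V ≃ Fin (Fintype.card V)) (k : ℕ) :
    (∀ x y, (G.overlay θ k).graph.Adj x y →
      (G.graph.Adj x y ∧ (G.overlay θ k).len x y = δ x y) ∨
      ∃ v, (θ v : ℕ) < k ∧ v ≠ x ∧ v ≠ y ∧ δ x v + δ v y ≤ (G.overlay θ k).len x y) ∧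
    (∀ x y, G.graph.Adj x y → k ≤ θ x → k ≤ θ y →
      (G.overlay θ k).graph.Adj x y ∧ (G.overlay θ k).len x y = δ x y) := by
  induction k with
  | zero =>
    refine ⟨fun x y e => .inl ⟨e, hG.len_eq _ _ e⟩, fun x y e _ _ => ⟨e, hG.len_eq _ _ e⟩⟩
  | succ k ih =>
    obtain ⟨ih1, ih2⟩ := ih
    by_cases hk : k < Fintype.card V
    · have hov : G.overlay θ (k + 1) = (G.overlay θ k).contract (θ.symm ⟨k, hk⟩) := by
        simp [overlay, hk]
      rw [hov]
      set H := G.overlay θ k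
      set v := θ.symm ⟨k, hk⟩ with hv
      have hθv : (θ v : ℕ) = k := by simp [hv]
      have hle : ∀ x y, H.graph.Adj x y → δ x y ≤ H.len x y := by
        intro x y e
        rcases ih1 x y e with h | ⟨w, -, -, -, h⟩
        · exact h.2.ge
        · exact (hG.tri x w y).trans h
      refine ⟨fun x y e => ?_, fun x y e hx hy => ?_⟩
      · by_cases hs : H.NeedsShortcut v x y
        · right
          refine ⟨v, by omega, hs.2.1.ne', hs.2.2.1.ne, ?_⟩
          simp only [contract, if_pos hs]
          exact add_le_add (hle _ _ hs.2.1) (hle _ _ hs.2.2.1)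
        · have e' : H.graph.Adj x y := (e.resolve_right hs).1
          simp only [contract, if_neg hs]
          rcases ih1 x y e' with h | ⟨w, hw, h⟩
          · exact .inl h
          · exact .inr ⟨w, by omega, h⟩
      · obtain ⟨f, hf⟩ := ih2 x y e (by omega) (by omega)
        refine ⟨.inl ⟨f, ?_, ?_⟩, ?_⟩
        · rintro rfl; omega
        · rintro rfl; omega
        -- A shortcut may run parallel to an original edge, whose length is then overwritten; being
        -- a shortest path, it still has length `δ x y`.
        · by_cases hs : H.NeedsShortcut v x y
          · simp only [contract, if_pos hs]
            have h1 := hle _ _ hs.2.1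
            have h2 := hle _ _ hs.2.2.1
            have h3 := H.sdist_le_len f
            rw [hs.2.2.2.1, hf] at h3
            have h3 : H.len x v + H.len v y ≤ δ x y := by exact_mod_cast h3
            have h4 := hG.tri x v y
            omega
          · simp only [contract, if_neg hs, hf]
    · have hov : G.overlay θ (k + 1) = G.overlay θ k := by
        simp [overlay, hk]
      rw [hov]
      refine ⟨fun x y e => ?_, fun x y e hx hy => ih2 x y e (by omega) (by omega)⟩
      rcases ih1 x y e with h | ⟨w, hw, h⟩
      · exact .inl h
      · exact .inr ⟨w, by omega, h⟩

/-- If `v` is the only vertex between `s` and `t`, and `v` is contracted before both, the shortcut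
`st` is added. -/
theorem isShortcut_of_between (hG : G.IsGeodesic δ) (θ : V ≃ Fin (Fintype.card V)) {s v t : V}
    (hsv : G.graph.Adj s v) (hvt : G.graph.Adj v t) (hst : s ≠ t) (hn : ¬ G.graph.Adj s t)
    (hd : δ s t = δ s v + δ v t)
    (huniq : ∀ x, x ≠ s → x ≠ t → δ s x + δ x t ≤ δ s t → x = v)
    (hs : θ v < θ s) (ht : θ v < θ t) : G.IsShortcut θ s t := by
  obtain ⟨i1, i2⟩ := hG.overlay_invariant θ (θ v)
  refine ⟨v, ?_⟩
  set H := G.overlay θ (θ v)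
  have hs' : (θ v : ℕ) ≤ θ s := hs.le
  have ht' : (θ v : ℕ) ≤ θ t := ht.le
  obtain ⟨a1, l1⟩ := i2 s v hsv hs' le_rfl
  obtain ⟨a2, l2⟩ := i2 v t hvt le_rfl ht'
  have hle : ∀ x y, H.graph.Adj x y → δ x y ≤ H.len x y := by
    intro x y e
    rcases i1 x y e with h | ⟨w, -, -, -, h⟩
    · exact h.2.ge
    · exact (hG.tri x w y).trans h
  refine ⟨hst, a1, a2, le_antisymm ?_ ?_, ?_⟩
  · simpa using H.sdist_le_walkLen (SimpleGraph.Walk.cons a1 (.cons a2 .nil))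
  · rw [l1, l2, ← hd]
    exact le_sdist hG.self hG.tri hle s t
  · rw [l1, l2, ← hd]
    have key : ((δ s t + 1 : ℕ) : ℕ∞) ≤ (H.delete v).sdist s t := by
      refine le_iInf fun p => ?_
      have : δ s t + 1 ≤ (H.delete v).walkLen p := by
        cases p with
        | nil => exact absurd rfl hst
        | @cons _ x _ e p =>
          rw [walkLen_cons]
          have hx : x ≠ v := e.2.2
          have h1 : δ x t ≤ (H.delete v).walkLen p :=
            WGraph.le_walkLen (G := H.delete v) hG.self hG.tri (fun a b f => hle a b f.1) p
          have h2 : δ s x ≤ (H.delete v).len s x := hle s x e.1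
          -- A tight walk avoiding `v` cannot exist: its first step ends at a vertex between `s` and
          -- `t`, which is `v`, or is an edge `st`. The latter is not original, so it bridges an
          -- earlier contracted vertex, which would again be `v`.
          by_contra! hlt
          by_cases hxt : x = t
          · subst hxt
            rcases i1 s x e.1 with h | ⟨w, hw, hws, hwt, h⟩
            · exact hn h.1
            · have h' : δ s w + δ w x ≤ (H.delete v).len s x := h
              have := huniq w hws hwt (by omega)
              subst this
              omega
          · exact hx (huniq x e.1.ne' hxt (by omega))
      exact_mod_cast this
    refine lt_of_lt_of_le ?_ key
    exact_mod_cast Nat.lt_succ_self _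

end IsGeodesic

/-! ### Lower bounds on the search time -/

section SearchTime

variable [Fintype V] (G : WGraph V) (θ : V ≃ Fin (Fintype.card V))

theorem card_le_searchTime {s : V} (S : Finset V) (hS : ∀ t ∈ S, t ∈ G.settled θ s) :
    S.card ≤ G.searchTime θ s := by
  have h := Set.ncard_le_ncard (s := (S : Set V)) (t := G.settled θ s) hS (Set.toFinite _)
  rw [Set.ncard_coe_finset] at h
  unfold searchTime
  omega

/-- The search scans a quadratic number of edges in a settled clique. -/
theorem card_sq_le_searchTime {s : V} (S : Finset V) (hS : ∀ t ∈ S, t ∈ G.settled θ s)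
    (hclique : ∀ u ∈ S, ∀ v ∈ S, u ≠ v → G.graph.Adj u v) :
    S.card ^ 2 ≤ 2 * G.searchTime θ s := by
  classical
  set R := (G.scanned θ s).toFinite.toFinset with hR
  have hRc : R.card = (G.scanned θ s).ncard := by
    rw [Set.ncard_eq_toFinset_card _ (G.scanned θ s).toFinite]
  -- Every edge of the clique is scanned from its end contracted first; the diagonal is paid for by
  -- the settled vertices.
  have hsub : S ×ˢ S ⊆ (R ∪ R.image Prod.swap) ∪ S.image (fun x => (x, x)) := by
    rintro ⟨u, v⟩ huv
    obtain ⟨hu, hv⟩ := Finset.mem_product.1 huv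
    simp only [Finset.mem_union, Finset.mem_image, hR, Set.Finite.mem_toFinset]
    rcases lt_trichotomy (θ u) (θ v) with h | h | h
    · exact .inl (.inl ⟨hS u hu, .inl (hclique u hu v hv fun e => by simp [e] at h), h⟩)
    · exact .inr ⟨u, hu, by rw [θ.injective h]⟩
    · exact .inl (.inr ⟨(v, u),
        ⟨hS v hv, .inl (hclique v hv u hu fun e => by simp [e] at h), h⟩, rfl⟩)
  have h1 := Finset.card_le_card hsub
  have h2 := Finset.card_union_le (R ∪ R.image Prod.swap) (S.image (fun x => (x, x)))
  have h3 := Finset.card_union_le R (R.image Prod.swap)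
  have h4 : (R.image Prod.swap).card ≤ R.card := Finset.card_image_le
  have h5 : (S.image (fun x => (x, x))).card ≤ S.card := Finset.card_image_le
  have h6 := Set.ncard_le_ncard (s := (S : Set V)) (t := G.settled θ s) hS (Set.toFinite _)
  rw [Set.ncard_coe_finset] at h6
  rw [Finset.card_product] at h1
  unfold searchTime
  nlinarith

end SearchTime

end WGraph

/-- In a finite set ranked by `f`, at most `x` elements have fewer than `x` elements above or equal
to them. -/
theorem Finset.card_le_card_filter_add {ι κ : Type*} [LinearOrder κ] (S : Finset ι) (f : ι → κ)
    {x : ℝ} (hx : 0 ≤ x) :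
    (S.card : ℝ) ≤
      ((S.filter fun s => x ≤ ((S.filter fun t => f s ≤ f t).card : ℝ)).card : ℝ) + x := by
  classical
  rw [← Finset.card_filter_add_card_filter_not (s := S)
    (fun s => x ≤ ((S.filter fun t => f s ≤ f t).card : ℝ))]
  push_cast
  gcongr
  set R := S.filter fun s => ¬ x ≤ ((S.filter fun t => f s ≤ f t).card : ℝ) with hR
  rcases R.eq_empty_or_nonempty with h | h
  · simpa [h] using hx
  -- All of `R` ranks at or above its lowest element `m`, so `m ∈ R` bounds the size of `R`.
  · obtain ⟨m, hm, hmin⟩ := R.exists_min_image f h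
    have hm' := (Finset.mem_filter.1 hm).2
    have : R.card ≤ (S.filter fun t => f m ≤ f t).card :=
      Finset.card_le_card fun t ht =>
        Finset.mem_filter.2 ⟨(Finset.mem_filter.1 ht).1, hmin t ht⟩
    have : (R.card : ℝ) ≤ ((S.filter fun t => f m ≤ f t).card : ℝ) := by exact_mod_cast this
    linarith

/-! ### Combinatorics of the hub graph -/

/-- Hubs `Sum.inl j` and leaves `Sum.inr (i, a)`, the `a`-th leaf of type `i`. -/
abbrev HubVertex (h N : ℕ) : Type := Fin h ⊕ Fin h × Fin N

namespace HubVertex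

variable {h N : ℕ}

/-- The distance in the hub graph, in units of its shortest edge. -/
def baseDist : HubVertex h N → HubVertex h N → ℕ
  | .inl i, .inl j => if i = j then 0 else 2
  | .inl j, .inr t => if t.1 = j then 1 else if t.1 < j then 2 else 3
  | .inr s, .inl j => if s.1 = j then 1 else if s.1 < j then 2 else 3
  | .inr s, .inr t => if s = t then 0 else if s.1 = t.1 then 2 else 3

/-- The hubs form a clique, and a leaf of type `i` is adjacent to the hubs `j ≥ i`. -/
def Adj : HubVertex h N → HubVertex h N → Prop
  | .inl i, .inl j => i ≠ j
  | .inl j, .inr t => t.1 ≤ j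
  | .inr s, .inl j => s.1 ≤ j
  | .inr _, .inr _ => False

/-- The first vertex after the start on the shortest path between two vertices. -/
def next : HubVertex h N → HubVertex h N → HubVertex h N
  | .inl _, .inl j => .inl j
  | .inl j, .inr t => if t.1 ≤ j then .inr t else .inl t.1
  | .inr s, .inl j => if s.1 ≤ j then .inl j else .inl s.1
  | .inr s, .inr t => .inl (max s.1 t.1)

theorem baseDist_self (u : HubVertex h N) : baseDist u u = 0 := by
  cases u <;> simp [baseDist]

theorem baseDist_comm (u v : HubVertex h N) : baseDist u v = baseDist v u := by
  rcases u with i | s <;> rcases v with j | t <;> simp only [baseDist, eq_comm]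

theorem baseDist_pos {u v : HubVertex h N} (huv : u ≠ v) : 0 < baseDist u v := by
  rcases u with i | s <;> rcases v with j | t <;> simp only [baseDist] <;> split_ifs <;> simp_all

theorem baseDist_le_three (u v : HubVertex h N) : baseDist u v ≤ 3 := by
  rcases u with i | s <;> rcases v with j | t <;> simp only [baseDist] <;> split_ifs <;> omega

/-- Nonzero values lie in $\{1,2,3\}$, so only $1+1<3$ could fail; but two unit steps join leaves of
the same type or return to the same hub. -/
theorem baseDist_triangle (u v w : HubVertex h N) :
    baseDist u w ≤ baseDist u v + baseDist v w := by
  rcases u with i | ⟨i, a⟩ <;> rcases v with j | ⟨j, b⟩ <;> rcases w with k | ⟨k, c⟩ <;>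
    simp only [baseDist, Prod.mk.injEq] <;> grind

theorem adj_next {u v : HubVertex h N} (huv : u ≠ v) : Adj u (next u v) := by
  rcases u with i | ⟨i, a⟩ <;> rcases v with j | ⟨j, b⟩ <;> simp only [next] <;>
    grind [Adj]

theorem baseDist_next {u v : HubVertex h N} (huv : u ≠ v) :
    baseDist u v = baseDist u (next u v) + baseDist (next u v) v := by
  rcases u with i | ⟨i, a⟩ <;> rcases v with j | ⟨j, b⟩ <;> simp only [next] <;>
    grind [baseDist]

/-- Ties are broken because each leaf has only one hub at distance 1: a detour using any other hub
or a leaf is strictly longer. -/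
theorem eq_next {u v x : HubVertex h N} (huv : u ≠ v) (hx : Adj u x)
    (hd : baseDist u v = baseDist u x + baseDist x v) : x = next u v := by
  rcases u with i | ⟨i, a⟩ <;> rcases v with j | ⟨j, b⟩ <;> rcases x with k | ⟨k, c⟩ <;>
    simp only [next, baseDist, Adj] at * <;> grind

theorem Adj.symm {u v : HubVertex h N} (huv : Adj u v) : Adj v u := by
  rcases u with i | s <;> rcases v with j | t <;> simp_all [Adj, eq_comm]

theorem Adj.ne {u v : HubVertex h N} (huv : Adj u v) : u ≠ v := by
  rintro rfl
  rcases u with i | s <;> simp [Adj] at huv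

/-- The shortest path between two leaves has a single interior vertex, so both access nodes coincide
with it. -/
theorem leaf_between {i j : Fin h} {a b : Fin N} {x y : HubVertex h N}
    (hxs : x ≠ .inr (i, a)) (hxt : x ≠ .inr (j, b)) (hys : y ≠ .inr (i, a)) (hyt : y ≠ .inr (j, b))
    (hd : baseDist (.inr (i, a)) x + baseDist x y + baseDist y (.inr (j, b)) ≤
      baseDist (.inr (i, a)) (.inr (j, b))) :
    x = .inl (max i j) ∧ y = .inl (max i j) := by
  rcases x with k | ⟨k, c⟩ <;> rcases y with l | ⟨l, d⟩ <;>
    simp only [baseDist] at * <;> grind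

end HubVertex

/-! ### Diameter and highway dimension -/

open HubVertex

/-- The hub graph with all distances scaled by `D`. -/
def hubGraph (h N D : ℕ) : WGraph (HubVertex h N) where
  graph :=
    { Adj := HubVertex.Adj
      symm := ⟨fun _ _ e => e.symm⟩
      loopless := ⟨fun _ e => e.ne rfl⟩ }
  len := fun u v => D * baseDist u v
  len_comm := fun u v => by rw [baseDist_comm]

namespace hubGraph

variable {h N D : ℕ}

theorem isGeodesic (hD : 1 ≤ D) :
    (hubGraph h N D).IsGeodesic (fun u v => D * baseDist u v) where
  self v := by simp [baseDist_self]
  pos u v huv := Nat.mul_pos hD (baseDist_pos huv)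
  tri u v w := by
    rw [← Nat.mul_add]
    exact Nat.mul_le_mul_left D (baseDist_triangle u v w)
  len_eq _ _ _ := rfl
  exists_next u v huv :=
    ⟨next u v, adj_next huv, by rw [← Nat.mul_add, ← baseDist_next huv]⟩
  next_unique u v x y huv hx hy hdx hdy := by
    rw [← Nat.mul_add] at hdx hdy
    rw [eq_next huv hx (Nat.eq_of_mul_eq_mul_left hD hdx),
      eq_next huv hy (Nat.eq_of_mul_eq_mul_left hD hdy)]

theorem sdist_eq (hD : 1 ≤ D) (u v : HubVertex h N) :
    (hubGraph h N D).sdist u v = ((D * baseDist u v : ℕ) : ℕ∞) :=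
  (isGeodesic hD).sdist_eq u v

theorem diam_le (hD : 1 ≤ D) : (hubGraph h N D).diam ≤ ((3 : ℕ) : ℕ∞) * D := by
  refine iSup_le fun u => iSup_le fun v => ?_
  rw [sdist_eq hD]
  have : D * baseDist u v ≤ 3 * D := by
    rw [mul_comm]
    exact Nat.mul_le_mul_right D (baseDist_le_three u v)
  exact_mod_cast this

theorem le_diam (hD : 1 ≤ D) (hh : 1 ≤ h) (hN : 1 ≤ N) : (D : ℕ∞) ≤ (hubGraph h N D).diam := by
  let u : HubVertex h N := .inl ⟨0, hh⟩
  let v : HubVertex h N := .inr (⟨0, hh⟩, ⟨0, hN⟩)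
  have h1 : (hubGraph h N D).sdist u v ≤ (hubGraph h N D).diam :=
    le_iSup_of_le u (le_iSup (fun v => (hubGraph h N D).sdist u v) v)
  rw [sdist_eq hD] at h1
  simpa [baseDist, u, v] using h1

theorem exists_hub_mem_edge {u v : HubVertex h N} (e : HubVertex.Adj u v) :
    ∃ j : Fin h, (Sum.inl j : HubVertex h N) = u ∨ (Sum.inl j : HubVertex h N) = v := by
  rcases u with i | s
  · exact ⟨i, .inl rfl⟩
  · rcases v with j | t
    · exact ⟨j, .inr rfl⟩
    · exact e.elim

/-- Every edge has a hub as an endpoint, and `0 < r` excludes paths without edges. -/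
theorem covers_hubs {r : ℝ} (hr : 0 < r) (B : Set (HubVertex h N)) :
    (hubGraph h N D).Covers (Finset.univ.map Function.Embedding.inl) r B := by
  intro u w p _ hlen _
  cases p with
  | nil =>
    rw [WGraph.walkLen_nil] at hlen
    norm_num at hlen
    linarith
  | @cons _ x _ e p =>
    obtain ⟨j, hj | hj⟩ := exists_hub_mem_edge e
    · exact ⟨u, by simp, by simp [← hj]⟩
    · exact ⟨x, by simp, by simp [← hj]⟩

theorem highwayDim_eq (hD : 1 ≤ D) (hh : 1 ≤ h) (hN : 1 ≤ N) :
    (hubGraph h N D).highwayDim = h := by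
  have hD0 : (0 : ℝ) < D := by exact_mod_cast hD
  have hmem : h ∈ {k : ℕ | ∀ r : ℝ, 0 < r → ∀ v : HubVertex h N, ∃ H : Finset (HubVertex h N),
      H.card ≤ k ∧ (hubGraph h N D).Covers H r ((hubGraph h N D).ball v (4 * r))} :=
    fun r hr v => ⟨Finset.univ.map Function.Embedding.inl, by simp, covers_hubs hr _⟩
  refine le_antisymm (Nat.sInf_le hmem) (le_csInf ⟨h, hmem⟩ fun k hk => ?_)
  -- At scale $r=D$ the ball is the whole graph, as distances are at most $3D$. It contains $h$
  -- disjoint shortest paths of length $D$: one edge from each hub to a leaf of its type.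
  obtain ⟨H, hHk, hH⟩ := hk D hD0 (.inl ⟨0, hh⟩)
  have hball : ∀ x, x ∈ (hubGraph h N D).ball (.inl ⟨0, hh⟩) (4 * D) := by
    intro x
    have h1 : D * baseDist x (.inl ⟨0, hh⟩) < 4 * D := by
      have := baseDist_le_three x (.inl ⟨0, hh⟩)
      nlinarith
    have h2 : ((4 : ℝ) * D) = ((4 * D : ℕ) : ℝ) := by push_cast; ring
    simp only [WGraph.ball, Set.mem_ofPred_eq, sdist_eq hD, h2, ENNReal.ofReal_natCast]
    exact_mod_cast h1
  have hcov : ∀ i : Fin h, ∃ x ∈ H, x = .inl i ∨ x = .inr (i, ⟨0, hN⟩) := by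
    intro i
    have e : (hubGraph h N D).graph.Adj (.inl i) (.inr (i, ⟨0, hN⟩)) := le_refl i
    obtain ⟨x, hx, hxH⟩ := hH _ _ _ ((isGeodesic hD).isShortestPath_edge e)
      (by rw [WGraph.walkLen_cons, WGraph.walkLen_nil]; simp [hubGraph, baseDist])
      (fun x _ => hball x)
    exact ⟨x, hxH, by simpa using hx⟩
  choose f hf hf' using hcov
  have hinj : Function.Injective f := by
    intro i j hij
    rcases hf' i with h1 | h1 <;> rcases hf' j with h2 | h2 <;> rw [hij, h2] at h1 <;>
      simp_all
  have := Finset.card_le_card_of_injOn f (s := Finset.univ) (t := H) (fun i _ => hf i)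
    hinj.injOn
  rw [Finset.card_univ, Fintype.card_fin] at this
  omega

/-! ### Global queries between leaves -/

/-- The access nodes of two leaves that are not transit nodes themselves have to contain the hub
in which they meet. -/
theorem hub_mem_of_isGlobal (hD : 1 ≤ D) {T : Finset (HubVertex h N)}
    {A : HubVertex h N → Finset (HubVertex h N)} (hA : ∀ v, A v ⊆ T) {s t : Fin h × Fin N}
    (hs : Sum.inr s ∉ T) (ht : Sum.inr t ∉ T)
    (hg : (hubGraph h N D).IsGlobal A (.inr s) (.inr t)) :
    Sum.inl (max s.1 t.1) ∈ A (.inr s) ∧ Sum.inl (max s.1 t.1) ∈ A (.inr t) := by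
  obtain ⟨u, hu, v, hv, hd⟩ := (isGeodesic hD).exists_of_isGlobal hg
  have hd : D * (baseDist (.inr s) u + baseDist u v + baseDist v (.inr t)) =
      D * baseDist (.inr s) (.inr t) := by rw [← hd]; ring
  have hd := (Nat.eq_of_mul_eq_mul_left hD hd).le
  have hne : ∀ x ∈ T, ∀ y ∉ T, x ≠ y := fun x hx y hy e => hy (e ▸ hx)
  obtain ⟨h1, h2⟩ := leaf_between (hne u (hA _ hu) _ hs) (hne u (hA _ hu) _ ht)
    (hne v (hA _ hv) _ hs) (hne v (hA _ hv) _ ht) hd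
  exact ⟨h1 ▸ hu, h2 ▸ hv⟩

/-- Among leaves with few access nodes, few pairs are global. -/
theorem card_global_le (hD : 1 ≤ D) {T : Finset (HubVertex h N)}
    {A : HubVertex h N → Finset (HubVertex h N)} (hA : ∀ v, A v ⊆ T)
    (S : Finset (Fin h × Fin N)) (hST : ∀ s ∈ S, Sum.inr s ∉ T) {B : ℝ}
    (hB : ∀ s ∈ S, ((A (.inr s)).card : ℝ) ≤ B) (P : Finset ((Fin h × Fin N) × (Fin h × Fin N)))
    (hP : ∀ p ∈ P, p.1 ∈ S ∧ p.2 ∈ S ∧ (hubGraph h N D).IsGlobal A (.inr p.1) (.inr p.2)) :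
    (P.card : ℝ) ≤ 2 * (S.card * (N * B)) := by
  classical
  -- A global pair is charged to its leaf `s` of smaller type: the other leaf then has its own hub
  -- in `A (.inr s)`, and each hub serves only `N` leaves.
  let R : Fin h × Fin N → Finset (Fin h × Fin N) := fun s =>
    Finset.univ.filter fun t => Sum.inl t.1 ∈ A (.inr s)
  have hR : ∀ s ∈ S, ((R s).card : ℝ) ≤ N * B := by
    intro s hs
    have h1 : (R s).card ≤ (A (.inr s) ×ˢ (Finset.univ : Finset (Fin N))).card := by
      refine Finset.card_le_card_of_injOn (fun t => (Sum.inl t.1, t.2)) ?_ ?_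
      · intro t ht
        simpa [R] using ht
      · intro t _ t' _ e
        simpa [Prod.ext_iff] using e
    rw [Finset.card_product, Finset.card_univ, Fintype.card_fin] at h1
    calc ((R s).card : ℝ) ≤ (A (.inr s)).card * N := by exact_mod_cast h1
      _ ≤ B * N := by gcongr; exact hB s hs
      _ = N * B := mul_comm _ _
  have hsub : P ⊆ (S.sigma R).image (fun x => (x.1, x.2)) ∪
      (S.sigma R).image (fun x => (x.2, x.1)) := by
    rintro ⟨s, t⟩ hp
    obtain ⟨hs, ht, hg⟩ := hP _ hp
    obtain ⟨h1, h2⟩ := hub_mem_of_isGlobal hD hA (hST s hs) (hST t ht) hg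
    rcases le_total s.1 t.1 with hle | hle
    · rw [max_eq_right hle] at h1
      refine Finset.mem_union_left _ (Finset.mem_image.2 ⟨⟨s, t⟩, ?_, rfl⟩)
      simpa [R] using ⟨hs, h1⟩
    · rw [max_eq_left hle] at h2
      refine Finset.mem_union_right _ (Finset.mem_image.2 ⟨⟨t, s⟩, ?_, rfl⟩)
      simpa [R] using ⟨ht, h2⟩
  have hsig : ((S.sigma R).card : ℝ) ≤ S.card * (N * B) := by
    rw [Finset.card_sigma, Nat.cast_sum]
    simpa using Finset.sum_le_card_nsmul S _ _ hR
  have h1 := Finset.card_le_card hsub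
  have h2 := Finset.card_union_le ((S.sigma R).image (fun x => (x.1, x.2)))
    ((S.sigma R).image (fun x => (x.2, x.1)))
  have h3 : ((S.sigma R).image (fun x => (x.1, x.2))).card ≤ _ := Finset.card_image_le
  have h4 : ((S.sigma R).image (fun x => (x.2, x.1))).card ≤ _ := Finset.card_image_le
  have h5 : (P.card : ℝ) ≤ (S.sigma R).card + (S.sigma R).card := by
    exact_mod_cast (h1.trans h2).trans (add_le_add h3 h4)
  linarith

/-! ### Contraction hierarchies on the hub graph -/

section Search

variable (θ : HubVertex h N ≃ Fin (Fintype.card (HubVertex h N)))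

theorem upArc_leaf_leaf (hD : 1 ≤ D) {j : Fin h} {a b : Fin N}
    (hj : θ (.inl j) < θ (.inr (j, a))) (hab : θ (.inr (j, a)) < θ (.inr (j, b))) :
    (hubGraph h N D).UpArc θ (.inr (j, a)) (.inr (j, b)) := by
  have hne : (Sum.inr (j, a) : HubVertex h N) ≠ .inr (j, b) := fun e => by simp [e] at hab
  have hd : baseDist (.inr (j, a) : HubVertex h N) (.inr (j, b)) = 2 := by
    have : (j, a) ≠ (j, b) := fun e => hne (by rw [e])
    simp [baseDist, this]
  refine ⟨.inr ?_, hab⟩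
  refine (isGeodesic hD).isShortcut_of_between θ (v := .inl j) (le_refl j) (le_refl j) hne
    (fun e => e) ?_ ?_ hj (hj.trans hab)
  · simp only [hd]
    simp [baseDist]; omega
  · intro x hxs hxt hle
    have hle : D * (baseDist (.inr (j, a)) x + baseDist x (.inr (j, b))) ≤
      D * baseDist (.inr (j, a)) (.inr (j, b)) := by rw [Nat.mul_add]; exact hle
    have := Nat.le_of_mul_le_mul_left hle hD
    simpa using (leaf_between (y := x) hxs hxt hxs hxt (by rwa [baseDist_self, add_zero])).1

/-- If most hubs are contracted late the search scans many edges between hubs, and if a hub is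
contracted early it settles many leaves of its type. -/
theorem card_expensive_ge (hD : 1 ≤ D) (hN : (h : ℝ) ^ 2 ≤ N) :
    (h : ℝ) * N / 8 ≤ ((Finset.univ.filter fun s : Fin h × Fin N =>
      (h : ℝ) ^ 2 / 32 ≤ (hubGraph h N D).searchTime θ (.inr s)).card : ℝ) := by
  classical
  set G := hubGraph h N D with hG
  set E := Finset.univ.filter fun s : Fin h × Fin N =>
      (h : ℝ) ^ 2 / 32 ≤ G.searchTime θ (.inr s) with hE
  have hN0 : (0 : ℝ) ≤ N := by positivity
  have hh0 : (0 : ℝ) ≤ h := by positivity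
  have hcount : ∀ (J : Finset (Fin h)) (X : Fin h → Finset (Fin N)) (x y : ℝ), 0 ≤ y → x ≤ J.card →
      (∀ j ∈ J, y ≤ ((X j).card : ℝ)) → (∀ j ∈ J, ∀ a ∈ X j, (j, a) ∈ E) →
      x * y ≤ E.card := by
    intro J X x y hy hx hX hXE
    have h1 : ((J.sigma X).card : ℝ) ≤ E.card := by
      have : (J.sigma X).card ≤ E.card := by
        refine Finset.card_le_card_of_injOn (fun z => (z.1, z.2)) ?_ ?_
        · intro z hz
          have := Finset.mem_sigma.1 hz
          exact hXE _ this.1 _ this.2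
        · rintro ⟨a, b⟩ _ ⟨c, d⟩ _ e
          simpa using e
      exact_mod_cast this
    have h2 : (J.card : ℝ) * y ≤ (J.sigma X).card := by
      rw [Finset.card_sigma, Nat.cast_sum]
      simpa using Finset.card_nsmul_le_sum J _ _ hX
    have h3 : x * y ≤ J.card * y := by gcongr
    linarith
  let above : Fin h → Finset (Fin N) := fun j =>
    Finset.univ.filter fun a => θ (.inl j) < θ (.inr (j, a))
  let below : Fin h → Finset (Fin N) := fun j =>
    Finset.univ.filter fun a => θ (.inr (j, a)) < θ (.inl j)
  have hab : ∀ j, ((above j).card : ℝ) + (below j).card = N := by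
    intro j
    have h1 := Finset.card_filter_add_card_filter_not (s := (Finset.univ : Finset (Fin N)))
      (fun a => θ (.inl j) < θ (.inr (j, a)))
    have h2 : below j = Finset.univ.filter fun a => ¬ θ (.inl j) < θ (.inr (j, a)) := by
      ext a
      have : θ (.inr (j, a)) ≠ θ (.inl j) := fun e => by simpa using θ.injective e
      simp only [below, Finset.mem_filter, Finset.mem_univ, true_and, not_lt]
      exact ⟨le_of_lt, fun h => lt_of_le_of_ne h this⟩
    rw [Finset.card_univ, Fintype.card_fin, ← h2] at h1
    exact_mod_cast h1
  let Early : Finset (Fin h) := Finset.univ.filter fun j => (N : ℝ) / 2 ≤ (above j).card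
  let Late : Finset (Fin h) := Finset.univ.filter fun j => ¬ (N : ℝ) / 2 ≤ (above j).card
  have hEL : (Early.card : ℝ) + Late.card = h := by
    have h1 := Finset.card_filter_add_card_filter_not (s := (Finset.univ : Finset (Fin h)))
      (fun j => (N : ℝ) / 2 ≤ (above j).card)
    rw [Finset.card_univ, Fintype.card_fin] at h1
    exact_mod_cast h1
  rcases le_total ((h : ℝ) / 2) Early.card with hcase | hcase
  -- Many early hubs: the later leaves of such a type are joined by shortcuts, and all but `N / 4`
  -- of them reach at least `N / 4` leaves.
  · have := hcount Early
      (fun j => (above j).filter fun a =>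
        (N : ℝ) / 4 ≤ (((above j).filter fun b => θ (.inr (j, a)) ≤ θ (.inr (j, b))).card : ℝ))
      (h / 2) (N / 4) (by positivity) hcase ?_ ?_
    · linarith
    · intro j hj
      have h1 := (Finset.mem_filter.1 hj).2
      have h2 := Finset.card_le_card_filter_add (above j) (fun a => θ (.inr (j, a)))
        (x := (N : ℝ) / 4) (by positivity)
      linarith
    · intro j _ a ha
      obtain ⟨ha, hcard⟩ := Finset.mem_filter.1 ha
      set Q := (above j).filter fun b => θ (.inr (j, a)) ≤ θ (.inr (j, b)) with hQ
      have h1 : (Q.map ⟨fun b => (Sum.inr (j, b) : HubVertex h N),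
          fun b c e => by simpa using e⟩).card ≤ G.searchTime θ (.inr (j, a)) := by
        refine G.card_le_searchTime θ _ ?_
        intro t ht
        obtain ⟨b, hb, rfl⟩ := Finset.mem_map.1 ht
        have hb := (Finset.mem_filter.1 hb).2
        rcases hb.lt_or_eq with hlt | heq
        · exact Relation.ReflTransGen.single
            (upArc_leaf_leaf θ hD (Finset.mem_filter.1 ha).2 hlt)
        · change Sum.inr (j, b) ∈ G.settled θ (.inr (j, a))
          rw [← θ.injective heq]
          exact Relation.ReflTransGen.refl
      rw [Finset.card_map] at h1
      have h1 : (Q.card : ℝ) ≤ G.searchTime θ (.inr (j, a)) := by exact_mod_cast h1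
      refine Finset.mem_filter.2 ⟨Finset.mem_univ _, ?_⟩
      have : (h : ℝ) ^ 2 / 32 ≤ N / 4 := by linarith
      linarith
  -- Many late hubs: a leaf contracted before its hub `j` climbs to `j` and then to all late hubs
  -- above `j`. For all but `h / 4` choices of `j` these form a clique of size at least `h / 4`,
  -- whence $(h/4)^2/2=h^2/32$.
  · have := hcount
      (Late.filter fun j =>
        (h : ℝ) / 4 ≤ ((Late.filter fun k => θ (.inl j) ≤ θ (.inl k)).card : ℝ))
      below (h / 4) (N / 2) (by positivity) ?_ ?_ ?_
    · linarith
    · have h2 := Finset.card_le_card_filter_add Late (fun j => θ (.inl j))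
        (x := (h : ℝ) / 4) (by positivity)
      linarith
    · intro j hj
      have h1 := (Finset.mem_filter.1 (Finset.mem_filter.1 hj).1).2
      have := hab j
      linarith
    · intro j hj a ha
      obtain ⟨hj, hcard⟩ := Finset.mem_filter.1 hj
      have ha := (Finset.mem_filter.1 ha).2
      set Q := Late.filter fun k => θ (.inl j) ≤ θ (.inl k) with hQ
      have h0 : G.UpArc θ (.inr (j, a)) (.inl j) := ⟨.inl (le_refl j), ha⟩
      have h1 : (Q.map ⟨fun k => (Sum.inl k : HubVertex h N), Sum.inl_injective⟩).card ^ 2 ≤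
          2 * G.searchTime θ (.inr (j, a)) := by
        refine G.card_sq_le_searchTime θ _ ?_ ?_
        · intro t ht
          obtain ⟨k, hk, rfl⟩ := Finset.mem_map.1 ht
          have hk := (Finset.mem_filter.1 hk).2
          rcases hk.lt_or_eq with hlt | heq
          · refine (Relation.ReflTransGen.single h0).tail ⟨.inl ?_, hlt⟩
            exact fun e => by simp [e] at hlt
          · rw [Function.Embedding.coeFn_mk, ← θ.injective heq]
            exact Relation.ReflTransGen.single h0
        · intro u hu v hv huv
          obtain ⟨k, -, rfl⟩ := Finset.mem_map.1 hu
          obtain ⟨l, -, rfl⟩ := Finset.mem_map.1 hv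
          exact fun e => huv (by simp [e])
      rw [Finset.card_map] at h1
      have h1 : (Q.card : ℝ) ^ 2 ≤ 2 * G.searchTime θ (.inr (j, a)) := by exact_mod_cast h1
      refine Finset.mem_filter.2 ⟨Finset.mem_univ _, ?_⟩
      have h3 : ((h : ℝ) / 4) ^ 2 ≤ (Q.card : ℝ) ^ 2 := by gcongr
      nlinarith

end Search

end hubGraph

/-! ### Average query time and number of access nodes -/

namespace WGraph

variable {V : Type} [Fintype V]

theorem le_avgTnrTime (G : WGraph V) (A : V → Finset V) (F : V → V → Prop)
    (θ : V ≃ Fin (Fintype.card V)) {ι : Type} (P : Finset (ι × ι)) {f : ι → V}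
    (hf : Function.Injective f) {x : ℝ} (hx : ∀ p ∈ P, x ≤ G.tnrTime A F θ (f p.1) (f p.2)) :
    P.card * x / (Fintype.card V : ℝ) ^ 2 ≤ G.avgTnrTime A F θ := by
  unfold avgTnrTime
  gcongr
  rw [← Fintype.sum_prod_type' (f := fun s t => (G.tnrTime A F θ s t : ℝ))]
  calc (P.card : ℝ) * x ≤ ∑ p ∈ P, (G.tnrTime A F θ (f p.1) (f p.2) : ℝ) := by
        simpa using Finset.card_nsmul_le_sum P _ _ hx
    _ = ∑ q ∈ P.map ⟨Prod.map f f, hf.prodMap hf⟩, (G.tnrTime A F θ q.1 q.2 : ℝ) := by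
        simp
    _ ≤ _ := Finset.sum_le_sum_of_subset_of_nonneg (Finset.subset_univ _)
        fun _ _ _ => Nat.cast_nonneg _

end WGraph

namespace hubGraph

variable {h N D : ℕ}

theorem card_hubVertex : Fintype.card (HubVertex h N) = h + h * N := by simp

theorem card_filter_notMem_ge (T : Finset (HubVertex h N)) (S : Finset (Fin h × Fin N)) :
    (S.card : ℝ) ≤ ((S.filter fun s => Sum.inr s ∉ T).card : ℝ) + T.card := by
  classical
  have h1 := Finset.card_filter_add_card_filter_not (s := S)
    (fun s => (Sum.inr s : HubVertex h N) ∈ T)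
  have h2 : (S.filter fun s => (Sum.inr s : HubVertex h N) ∈ T).card ≤ T.card :=
    Finset.card_le_card_of_injOn Sum.inr (fun s hs => (Finset.mem_filter.1 hs).2)
      Sum.inr_injective.injOn
  have : S.card ≤ (S.filter fun s => (Sum.inr s : HubVertex h N) ∉ T).card + T.card := by omega
  exact_mod_cast this

theorem avgTnrTime_ge (hD : 1 ≤ D) (hh : 1 ≤ h) (hN1 : 1 ≤ N) (hN : (h : ℝ) ^ 2 ≤ N)
    {T : Finset (HubVertex h N)} {A : HubVertex h N → Finset (HubVertex h N)} (hA : ∀ v, A v ⊆ T)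
    (hT : (T.card : ℝ) ≤ h * N / 16) (F : HubVertex h N → HubVertex h N → Prop)
    (θ : HubVertex h N ≃ Fin (Fintype.card (HubVertex h N)))
    (hF : ∀ s t, F s t → (hubGraph h N D).IsGlobal A s t) :
    1 / 2 ^ 27 * (h : ℝ) ^ 2 ≤ (hubGraph h N D).avgTnrTime A F θ := by
  classical
  set G := hubGraph h N D with hG
  have hh' : (1 : ℝ) ≤ h := by exact_mod_cast hh
  have hN' : (1 : ℝ) ≤ N := by exact_mod_cast hN1
  have hcard : (Fintype.card (HubVertex h N) : ℝ) = h + h * N := by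
    rw [card_hubVertex]; push_cast; rfl
  -- $2048\cdot16384=2^{25}$; the other factor 4 comes from $|V|\le 2hN$.
  suffices hP : ∃ P : Finset ((Fin h × Fin N) × (Fin h × Fin N)),
      ((h : ℝ) * N) ^ 2 / 2048 ≤ P.card ∧
      ∀ p ∈ P, (h : ℝ) ^ 2 / 16384 ≤ G.tnrTime A F θ (.inr p.1) (.inr p.2) by
    obtain ⟨P, hP1, hP2⟩ := hP
    refine le_trans ?_ (G.le_avgTnrTime A F θ P Sum.inr_injective hP2)
    rw [hcard, le_div_iff₀ (by positivity)]
    have h1 : (h + h * N : ℝ) ^ 2 ≤ (2 * (h * N)) ^ 2 := by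
      gcongr
      nlinarith
    calc 1 / 2 ^ 27 * (h : ℝ) ^ 2 * (h + h * N : ℝ) ^ 2
        ≤ 1 / 2 ^ 27 * (h : ℝ) ^ 2 * (2 * (h * N)) ^ 2 := by gcongr
      _ = ((h : ℝ) * N) ^ 2 / 2048 * ((h : ℝ) ^ 2 / 16384) := by ring
      _ ≤ _ := by gcongr
  have hE := card_expensive_ge θ hD hN
  set E := Finset.univ.filter fun s : Fin h × Fin N =>
      (h : ℝ) ^ 2 / 32 ≤ (hubGraph h N D).searchTime θ (.inr s) with hEdef
  have hE' := card_filter_notMem_ge T E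
  set E' := E.filter fun s => Sum.inr s ∉ T with hE'def
  have hch : ∀ s ∈ E', ∀ t, (h : ℝ) ^ 2 / 16384 ≤ (G.chTime θ (.inr s) t : ℝ) := by
    intro s hs t
    have h1 := (Finset.mem_filter.1 (Finset.mem_filter.1 hs).1).2
    have h2 : (0 : ℝ) ≤ G.searchTime θ t := Nat.cast_nonneg _
    simp only [WGraph.chTime, Nat.cast_add]
    rw [← hG] at h1
    have : (0 : ℝ) ≤ (h : ℝ) ^ 2 := by positivity
    linarith
  set small := E'.filter fun s => ((A (.inr s)).card : ℝ) ≤ h / 128 with hsmall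
  set big := E'.filter fun s => ¬ ((A (.inr s)).card : ℝ) ≤ h / 128 with hbig
  have hsb : (small.card : ℝ) + big.card = E'.card := by
    exact_mod_cast Finset.card_filter_add_card_filter_not (s := E')
      (fun s => ((A (.inr s)).card : ℝ) ≤ h / 128)
  have hhN : (0 : ℝ) ≤ h * N := by positivity
  -- At least $hN/8-hN/16$ expensive leaves avoid `T`, so one of the two classes contains $hN/32$ of
  -- them.
  rcases le_total ((h : ℝ) * N / 32) big.card with hc | hc
  · refine ⟨big ×ˢ big, ?_, ?_⟩
    · rw [Finset.card_product]
      push_cast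
      nlinarith
    · rintro ⟨s, t⟩ hp
      obtain ⟨hs, ht⟩ := Finset.mem_product.1 hp
      have hs := Finset.mem_filter.1 hs
      have ht := Finset.mem_filter.1 ht
      unfold WGraph.tnrTime
      split_ifs
      · push_cast
        have h1 := (not_le.1 hs.2).le
        have h2 := (not_le.1 ht.2).le
        calc (h : ℝ) ^ 2 / 16384 = (h / 128) * (h / 128) := by ring
          _ ≤ _ := mul_le_mul h1 h2 (by positivity) (by positivity)
      · exact hch _ hs.1 _
  · have hc' : (h : ℝ) * N / 32 ≤ small.card := by linarith
    set P := (small ×ˢ small).filter fun p => G.IsGlobal A (.inr p.1) (.inr p.2) with hP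
    set Q := (small ×ˢ small).filter fun p => ¬ G.IsGlobal A (.inr p.1) (.inr p.2) with hQ
    have hPQ : (P.card : ℝ) + Q.card = small.card * small.card := by
      have := Finset.card_filter_add_card_filter_not (s := small ×ˢ small)
        (fun p => G.IsGlobal A (.inr p.1) (.inr p.2))
      rw [Finset.card_product] at this
      exact_mod_cast this
    have hPle : (P.card : ℝ) ≤ 2 * (small.card * (N * (h / 128))) := by
      refine card_global_le hD hA small
        (fun s hs => (Finset.mem_filter.1 (Finset.mem_filter.1 hs).1).2)
        (fun s hs => (Finset.mem_filter.1 hs).2) P ?_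
      intro p hp
      obtain ⟨h1, h2⟩ := Finset.mem_filter.1 hp
      exact ⟨(Finset.mem_product.1 h1).1, (Finset.mem_product.1 h1).2, h2⟩
    refine ⟨Q, ?_, ?_⟩
    -- Global pairs number at most $|small|\cdot hN/64\le|small|^2/2$, so half of all pairs are
    -- local.
    · nlinarith
    · rintro ⟨s, t⟩ hp
      obtain ⟨h1, h2⟩ := Finset.mem_filter.1 hp
      unfold WGraph.tnrTime
      rw [if_neg fun hf => h2 (hF _ _ hf)]
      exact hch _ (Finset.mem_filter.1 (Finset.mem_product.1 h1).1).1 _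

/-- Otherwise at least half of all vertices are leaves outside `T` with few access nodes, and
`card_global_le` makes too many of their pairs local. -/
theorem card_many_accessNodes_ge (hD : 1 ≤ D) (hh : 1 ≤ h) (hN : 16 ≤ N)
    {T : Finset (HubVertex h N)} {A : HubVertex h N → Finset (HubVertex h N)} (hA : ∀ v, A v ⊆ T)
    (hT : (T.card : ℝ) ≤ h * N / 16) {c : ℝ} (hc : c ≤ 1 / 64)
    (hloc : ({e : HubVertex h N × HubVertex h N |
        ¬ (hubGraph h N D).IsGlobal A e.1 e.2}.ncard : ℝ)
      < (1 / 16) * (Fintype.card (HubVertex h N) : ℝ) ^ 2) :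
    c * (Fintype.card (HubVertex h N) : ℝ) ≤
      ({v : HubVertex h N | c * (h : ℝ) ≤ ((A v).card : ℝ)}.ncard : ℝ) := by
  classical
  set G := hubGraph h N D with hG
  have hh' : (1 : ℝ) ≤ h := by exact_mod_cast hh
  have hN' : (16 : ℝ) ≤ N := by exact_mod_cast hN
  set n : ℝ := (Fintype.card (HubVertex h N) : ℝ) with hn
  have hcard : n = h + h * N := by
    rw [hn, card_hubVertex]; push_cast; rfl
  by_contra! hlt
  set L := (Finset.univ : Finset (Fin h × Fin N)).filter fun s => Sum.inr s ∉ T with hL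
  have hL1 : (h : ℝ) * N ≤ L.card + T.card := by
    simpa using card_filter_notMem_ge T (Finset.univ : Finset (Fin h × Fin N))
  set small := L.filter fun s => ((A (.inr s)).card : ℝ) ≤ c * h with hsmall
  have hbig : (L.card : ℝ) ≤ small.card + c * n := by
    have h1 : small.card + (L.filter fun s => ¬ ((A (.inr s)).card : ℝ) ≤ c * h).card = L.card :=
      Finset.card_filter_add_card_filter_not _
    have h2 : (L.filter fun s => ¬ ((A (.inr s)).card : ℝ) ≤ c * h).card ≤
        {v : HubVertex h N | c * (h : ℝ) ≤ ((A v).card : ℝ)}.ncard := by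
      rw [← Set.ncard_coe_finset, ← Set.ncard_image_of_injective _ Sum.inr_injective]
      refine Set.ncard_le_ncard ?_ (Set.toFinite _)
      rintro _ ⟨s, hs, rfl⟩
      exact (not_le.1 (Finset.mem_filter.1 hs).2).le
    have h3 : L.card ≤ small.card +
        {v : HubVertex h N | c * (h : ℝ) ≤ ((A v).card : ℝ)}.ncard := by omega
    have h4 : (L.card : ℝ) ≤ small.card +
        {v : HubVertex h N | c * (h : ℝ) ≤ ((A v).card : ℝ)}.ncard := by exact_mod_cast h3
    linarith
  set P := (small ×ˢ small).filter fun p => G.IsGlobal A (.inr p.1) (.inr p.2) with hP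
  set Q := (small ×ˢ small).filter fun p => ¬ G.IsGlobal A (.inr p.1) (.inr p.2) with hQ
  have hPQ : (P.card : ℝ) + Q.card = small.card * small.card := by
    have := Finset.card_filter_add_card_filter_not (s := small ×ˢ small)
      (fun p => G.IsGlobal A (.inr p.1) (.inr p.2))
    rw [Finset.card_product] at this
    exact_mod_cast this
  have hPle : (P.card : ℝ) ≤ 2 * (small.card * (N * (c * h))) := by
    refine card_global_le hD hA small
      (fun s hs => (Finset.mem_filter.1 (Finset.mem_filter.1 hs).1).2)
      (fun s hs => (Finset.mem_filter.1 hs).2) P ?_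
    intro p hp
    obtain ⟨h1, h2⟩ := Finset.mem_filter.1 hp
    exact ⟨(Finset.mem_product.1 h1).1, (Finset.mem_product.1 h1).2, h2⟩
  have hQle : (Q.card : ℝ) < 1 / 16 * n ^ 2 := by
    refine lt_of_le_of_lt ?_ hloc
    have : Q.card ≤ {e : HubVertex h N × HubVertex h N | ¬ G.IsGlobal A e.1 e.2}.ncard := by
      rw [← Set.ncard_coe_finset, ← Set.ncard_image_of_injective _
        (Sum.inr_injective.prodMap Sum.inr_injective :
          Function.Injective (Prod.map (Sum.inr : Fin h × Fin N → HubVertex h N) Sum.inr))]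
      refine Set.ncard_le_ncard ?_ (Set.toFinite _)
      rintro _ ⟨p, hp, rfl⟩
      exact (Finset.mem_filter.1 hp).2
    exact_mod_cast this
  have hnN : (h : ℝ) * N ≤ n := by linarith
  have hNn : n ≤ 17 / 16 * (h * N) := by nlinarith
  have hn0 : 0 ≤ n := by nlinarith
  have hcn : c * n ≤ 1 / 64 * n := by gcongr
  have hsn : n / 2 ≤ small.card := by linarith
  have hPle' : (P.card : ℝ) ≤ 1 / 32 * n * small.card := by
    have : (N : ℝ) * (c * h) ≤ 1 / 64 * n := by
      calc (N : ℝ) * (c * h) = c * (h * N) := by ring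
        _ ≤ 1 / 64 * n := by gcongr
    have := mul_le_mul_of_nonneg_left this (Nat.cast_nonneg (α := ℝ) small.card)
    linarith
  -- With $|small|\ge n/2$, the local pairs number at least
  -- $|small|(|small|-n/32)\ge\tfrac{15}{64}n^2$, contradicting `hQle`.
  nlinarith

end hubGraph

/-! ### Choice of parameters -/

theorem mainTheorem5 :
    ∃ (c : ℝ) (C : ℕ), 0 < c ∧ ∀ (K : ℝ) (h D n : ℕ), 1 ≤ h → 1 ≤ D →
      ∃ (V : Type) (_ : Fintype V) (G : WGraph V),
        (∀ u v : V, G.graph.Adj u v → 0 < G.len u v) ∧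
        G.UniqueShortestPaths ∧
        G.highwayDim = h ∧
        (D : ℕ∞) ≤ C * G.diam ∧ G.diam ≤ C * (D : ℕ∞) ∧
        n ≤ Fintype.card V ∧
        ∀ (T : Finset V) (A : V → Finset V),
          (T.card : ℝ) ≤ K * √(Fintype.card V : ℝ) →
          (∀ v : V, A v ⊆ T) →
          (∀ (F : V → V → Prop) (θ : V ≃ Fin (Fintype.card V)),
            (∀ s t : V, F s t → G.IsGlobal A s t) →
            c * (h : ℝ) ^ 2 ≤ G.avgTnrTime A F θ) ∧
          (({e : V × V | ¬ G.IsGlobal A e.1 e.2}.ncard : ℝ)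
              < (1 / 16) * (Fintype.card V : ℝ) ^ 2 →
            c * (Fintype.card V : ℝ) ≤ ({v : V | c * (h : ℝ) ≤ ((A v).card : ℝ)}.ncard : ℝ)) := by
  refine ⟨1 / 2 ^ 27, 3, by norm_num, fun K h D n hh hD => ?_⟩
  -- The summands serve, in turn, the size of `V`, the shortcut cliques in (1), the bound
  -- $|V|\le\tfrac{17}{16}hN$ in (2), and $K\sqrt{|V|}\le|V|/32\le hN/16$.
  set N : ℕ := n + h ^ 2 + 16 + ⌈(32 * K) ^ 2⌉₊ with hN
  have hN16 : 16 ≤ N := by omega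
  have hhN : (h : ℝ) ^ 2 ≤ N := by
    have : h ^ 2 ≤ N := by omega
    exact_mod_cast this
  have hNV : N ≤ Fintype.card (HubVertex h N) := by
    rw [hubGraph.card_hubVertex]
    nlinarith
  refine ⟨HubVertex h N, inferInstance, hubGraph h N D, ?_, ?_, ?_, ?_, ?_, ?_, ?_⟩
  · exact fun u v e => Nat.mul_pos hD (HubVertex.baseDist_pos e.ne)
  · exact (hubGraph.isGeodesic hD).uniqueShortestPaths
  · exact hubGraph.highwayDim_eq hD hh (by omega)
  · exact (hubGraph.le_diam hD hh (by omega)).trans (le_mul_of_one_le_left zero_le (by norm_num))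
  · exact hubGraph.diam_le hD
  · omega
  · intro T A hTK hA
    have hT : (T.card : ℝ) ≤ h * N / 16 := by
      set m : ℝ := (Fintype.card (HubVertex h N) : ℝ) with hm
      have hcard : m = h + h * N := by
        rw [hm, hubGraph.card_hubVertex]; push_cast; rfl
      have hm2 : m ≤ 2 * (h * N) := by
        have h1 : (1 : ℝ) ≤ N := by exact_mod_cast (by omega : 1 ≤ N)
        have h2 : (0 : ℝ) ≤ h := by positivity
        nlinarith
      have hKm : 32 * K ≤ √m := by
        refine Real.le_sqrt_of_sq_le ((Nat.le_ceil _).trans ?_)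
        have : ⌈(32 * K) ^ 2⌉₊ ≤ Fintype.card (HubVertex h N) := by omega
        rw [hm]
        exact_mod_cast this
      have hsq : √m * √m = m := Real.mul_self_sqrt (by positivity)
      have h3 := mul_le_mul_of_nonneg_right hKm (Real.sqrt_nonneg m)
      linarith
    exact ⟨fun F θ hF => hubGraph.avgTnrTime_ge hD hh (by omega) hhN hA hT F θ hF,
      fun hloc => hubGraph.card_many_accessNodes_ge hD hh hN16 hA hT (by norm_num) hloc⟩
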